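/- Let $a<b$ be real, $\alpha\in(0,1)$, $\beta\in\mathbb{C}$ with $\operatorname{Re}\beta\ge 0$, and let $A(z)=\sum_k a_kz^k$ and $\bar A(z)=\sum_k \bar a_kz^k$ be complex analytic functions, given by these convergent series on discs around $0$ of radius larger than $(b-a)^{\operatorname{Re}\beta}$, such that, as formal power series, $$\Big(\sum_{k\ge0}a_k\Gamma(\beta k+\alpha)X^k\Big)\Big(\sum_{k\ge0}\bar a_k\Gamma(\beta k+1-\alpha)X^k\Big)=1 .$$ Assume that $A(1)$ is defined, real and nonzero, and that $A(\tau^\beta)$ and $\bar A(\tau^\beta)$ are real for $0<\tau\le b-a$. For a kernel $B\in\{A,\bar A\}$ and $\gamma>0$ put $${}^{B}I^{\gamma,\beta}_{a+}y(t)=\int_a^t(t-s)^{\gamma-1}B\big((t-s)^\beta\big)y(s)\,ds,\qquad {}^{B}I^{\gamma,\beta}_{b-}y(t)=\int_t^b(s-t)^{\gamma-1}B\big((s-t)^\beta\big)y(s)\,ds,$$ $${}^{A}_{C}D^{\alpha,\beta}_{a+}y={}^{\bar A}I^{1-\alpha,\beta}_{a+}y',\qquad {}^{A}_{RL}D^{\alpha,\beta}_{b-}y=-\frac{d}{dt}\Big({}^{\bar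 A}I^{1-\alpha,\beta}_{b-}y\Big),\qquad w(t)=\frac{(b-t)^{\alpha-1}A\big((b-t)^\beta\big)}{\Gamma(\alpha)A(1)},$$ acting componentwise on vector functions. Let $L:[a,b]\times\mathbb{R}^n\times\mathbb{R}^n\to\mathbb{R}$, $(t,x,u)\mapsto L(t,x,u)$, be piecewise continuously differentiable, that is, $C^1$ on each closed slab $[t_{k},t_{k+1}]\times\mathbb{R}^n\times\mathbb{R}^n$ for some finite partition $a=t_0<\dots<t_N=b$, and let $x_a,x_b\in\mathbb{R}^n$. Suppose that $x^*$ maximizes $$\mathcal{J}[x]=\frac{1}{\Gamma(\alpha)A(1)}\,{}^{A}I^{\alpha,\beta}_{a+}\Big[L\big(\cdot,x(\cdot),{}^{A}_{C}D^{\alpha,\beta}_{a+}x(\cdot)\big)\Big](b)=\int_a^b w(t)\,L\big(t,x(t),{}^{A}_{C}D^{\alpha,\beta}_{a+}x(t)\big)\,dt$$ among all curves $x:[a,b]\to\mathbb{R}^n$ that are piecewise continuously differentiable ($C^1$ on each closed interval of some finite partition of $[a,b]$) and satisfy $x(a)=x_a$, $x(b)=x_b$. Then, for every $t\in[a,b)$,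 the right Riemann–Liouville derivative below exists (as a one-sided derivative at $t=a$) and $${}^{A}_{RL}D^{\alpha,\beta}_{b-}\Big[w\,\nabla_uL\big(\cdot,x^*(\cdot),{}^{A}_{C}D^{\alpha,\beta}_{a+}x^*(\cdot)\big)\Big](t)+w(t)\,\nabla_xL\big(t,x^*(t),{}^{A}_{C}D^{\alpha,\beta}_{a+}x^*(t)\big)=0 .$$ -/

import Mathlib

open Set

namespace FOB

noncomputable section

/-- `A` is given on the disc `D(0, R)` by the convergent power series `∑ c n * z ^ n`. -/
def IsSeriesOnDisc (A : ℂ → ℂ) (c : ℕ → ℂ) (R : ℝ) : Prop :=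
  ∀ z : ℂ, ‖z‖ < R → HasSum (fun n => c n * z ^ n) (A z)

/-- The transform `∑ c n * Γ(β n + γ) * X ^ n` of the series `∑ c n * X ^ n`, for a kernel that is
used in an integral of order `γ`. It is a formal power series, since its radius of convergence
may be zero. -/
def gammaTransform (c : ℕ → ℂ) (γ : ℝ) (β : ℂ) : PowerSeries ℂ :=
  PowerSeries.mk fun n => c n * Complex.Gamma (β * n + γ)

/-- The series `c` of `A` (used in integrals of order `α`) and the series `d` of `Abar` (used in
integrals of order `1 - α`) satisfy `A_Γ * Abar_Γ = 1`. -/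
def IsConjugate (c d : ℕ → ℂ) (α : ℝ) (β : ℂ) : Prop :=
  gammaTransform c α β * gammaTransform d (1 - α) β = 1

/-- The function `τ ↦ A (τ ^ β)` is real-valued on `(0, l]`. -/
def IsRealKernel (A : ℂ → ℂ) (β : ℂ) (l : ℝ) : Prop :=
  ∀ τ ∈ Ioc (0 : ℝ) l, (A ((τ : ℂ) ^ β)).im = 0

/-- Left fractional integral of order `γ` with analytic kernel `A`. -/
def leftIntegral (A : ℂ → ℂ) (γ : ℝ) (β : ℂ) (a : ℝ) (x : ℝ → ℝ) (t : ℝ) : ℂ :=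
  ∫ s in a..t, (((t - s) ^ (γ - 1) : ℝ) : ℂ) * A (((t - s : ℝ) : ℂ) ^ β) * (x s : ℂ)

/-- Right fractional integral of order `γ` with analytic kernel `A`. -/
def rightIntegral (A : ℂ → ℂ) (γ : ℝ) (β : ℂ) (b : ℝ) (x : ℝ → ℝ) (t : ℝ) : ℂ :=
  ∫ s in t..b, (((s - t) ^ (γ - 1) : ℝ) : ℂ) * A (((s - t : ℝ) : ℂ) ^ β) * (x s : ℂ)

/-- Left Caputo derivative of a scalar function; `Abar` is the conjugate of the kernel. -/
def caputoLeft (Abar : ℂ → ℂ) (α : ℝ) (β : ℂ) (a : ℝ) (x : ℝ → ℝ) (t : ℝ) : ℂ :=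
  leftIntegral Abar (1 - α) β a (deriv x) t

/-- Right Riemann–Liouville derivative of a scalar function on `[a, b]`; `Abar` is the conjugate
of the kernel. The derivative is one-sided at the end points. -/
def rlRight (Abar : ℂ → ℂ) (α : ℝ) (β : ℂ) (a b : ℝ) (x : ℝ → ℝ) (t : ℝ) : ℂ :=
  -derivWithin (rightIntegral Abar (1 - α) β b x) (Icc a b) t

/-- Left Caputo derivative of a curve, componentwise. The real part is only a change of type when
`Abar` is a real kernel. -/
def caputoLeftVec {n : ℕ} (Abar : ℂ → ℂ) (α : ℝ) (β : ℂ) (a : ℝ)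
    (x : ℝ → EuclideanSpace ℝ (Fin n)) (t : ℝ) : EuclideanSpace ℝ (Fin n) :=
  WithLp.toLp 2 fun i => (caputoLeft Abar α β a (fun s => x s i) t).re

/-- The weight `w`. The real part is only a change of type when `A` is a real kernel and `A 1` is
real. -/
def weight (A : ℂ → ℂ) (α : ℝ) (β : ℂ) (b t : ℝ) : ℝ :=
  ((((b - t) ^ (α - 1) : ℝ) : ℂ) * A (((b - t : ℝ) : ℂ) ^ β) / (Complex.Gamma α * A 1)).re

/-- Piecewise continuously differentiable curves on `[a, b]`: continuously differentiable on each
closed interval of a finite partition (hence continuous on `[a, b]`). -/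
def IsPC1Curve {n : ℕ} (a b : ℝ) (x : ℝ → EuclideanSpace ℝ (Fin n)) : Prop :=
  ∃ (N : ℕ) (p : ℕ → ℝ), p 0 = a ∧ p N = b ∧
    ∀ k < N, p k < p (k + 1) ∧ ContDiffOn ℝ 1 x (Icc (p k) (p (k + 1)))

/-- Lagrangians on `[a, b] × ℝⁿ × ℝⁿ` that are piecewise continuously differentiable: continuously
differentiable on each closed slab of a finite partition of the time interval. -/
def IsPC1Lagrangian {n : ℕ} (a b : ℝ)
    (L : ℝ → EuclideanSpace ℝ (Fin n) → EuclideanSpace ℝ (Fin n) → ℝ) : Prop :=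
  ∃ (N : ℕ) (p : ℕ → ℝ), p 0 = a ∧ p N = b ∧
    ∀ k < N, p k < p (k + 1) ∧
      ContDiffOn ℝ 1
        (fun q : ℝ × EuclideanSpace ℝ (Fin n) × EuclideanSpace ℝ (Fin n) => L q.1 q.2.1 q.2.2)
        (Icc (p k) (p (k + 1)) ×ˢ univ)

/-- The functional `(Γ(α) A(1))⁻¹ I^{α,β}_{a+} [L(·, x, D x)] (b)`, where the integral has kernel
`A` and `D` is the left Caputo derivative. -/
def functional {n : ℕ} (A Abar : ℂ → ℂ) (α : ℝ) (β : ℂ) (a b : ℝ)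
    (L : ℝ → EuclideanSpace ℝ (Fin n) → EuclideanSpace ℝ (Fin n) → ℝ)
    (x : ℝ → EuclideanSpace ℝ (Fin n)) : ℝ :=
  (leftIntegral A α β a (fun t => L t (x t) (caputoLeftVec Abar α β a x t)) b
    / (Complex.Gamma α * A 1)).re

/-- Admissible curves: piecewise continuously differentiable with the prescribed end points. -/
def IsAdmissible {n : ℕ} (a b : ℝ) (xa xb : EuclideanSpace ℝ (Fin n))
    (x : ℝ → EuclideanSpace ℝ (Fin n)) : Prop :=
  IsPC1Curve a b x ∧ x a = xa ∧ x b = xb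

/-- Solutions of the fundamental variational problem: maximizers among admissible curves. -/
def IsSolution {n : ℕ} (A Abar : ℂ → ℂ) (α : ℝ) (β : ℂ) (a b : ℝ)
    (L : ℝ → EuclideanSpace ℝ (Fin n) → EuclideanSpace ℝ (Fin n) → ℝ)
    (xa xb : EuclideanSpace ℝ (Fin n)) (x : ℝ → EuclideanSpace ℝ (Fin n)) : Prop :=
  IsAdmissible a b xa xb x ∧
    ∀ y : ℝ → EuclideanSpace ℝ (Fin n), IsAdmissible a b xa xb y →
      functional A Abar α β a b L y ≤ functional A Abar α β a b L x

/-- `∇ₓ L` along `(t, x, D x)`. -/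
def gradX {n : ℕ} (Abar : ℂ → ℂ) (α : ℝ) (β : ℂ) (a : ℝ)
    (L : ℝ → EuclideanSpace ℝ (Fin n) → EuclideanSpace ℝ (Fin n) → ℝ)
    (x : ℝ → EuclideanSpace ℝ (Fin n)) (t : ℝ) : EuclideanSpace ℝ (Fin n) :=
  gradient (fun y => L t y (caputoLeftVec Abar α β a x t)) (x t)

/-- `∇ᵤ L` along `(t, x, D x)`. -/
def gradU {n : ℕ} (Abar : ℂ → ℂ) (α : ℝ) (β : ℂ) (a : ℝ)
    (L : ℝ → EuclideanSpace ℝ (Fin n) → EuclideanSpace ℝ (Fin n) → ℝ)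
    (x : ℝ → EuclideanSpace ℝ (Fin n)) (t : ℝ) : EuclideanSpace ℝ (Fin n) :=
  gradient (fun u => L t (x t) u) (caputoLeftVec Abar α β a x t)

end

end FOB

open MeasureTheory Filter Topology

/-! Perturb one coordinate of the maximizer by `ε • Φ`, where `Φ` is the primitive from `a` of a
continuous `φ` with zero mean. The end points stay fixed, and the Caputo derivative changes by `ε •
Z`, where `Z` is the left integral of `φ` of order `1 - α` with kernel `Abar`. Vanishing of the
first variation reads `∫ w (∂ₓL · Φ + ∂ᵤL · Z) = 0`.

Both `Φ` and `Z` are left convolutions of `φ`, so Fubini (`integral_mul_integral_swap`) turns this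
into `∫ φ H = 0`, where `H s` is `∫ w ∂ₓL` over `[s, b]` plus the right integral of `w ∂ᵤL` at `s`.
By du Bois-Reymond (`eq_const_of_integral_mul_eq_zero`), `H` equals a constant `C` on `[a, b)`.
Hence the right integral is `C` minus a primitive of a function continuous on `[a, b)`, and the
fundamental theorem of calculus gives both its differentiability and the equation.

The analytic burden is the continuity of `H` although the kernels may be singular at `0` and `w` at
`b` (`continuousOn_integral_comp_sub_mul`), and the continuity of the gradients along the curve in
spite of the breakpoints of `x` and `L`. -/

namespace FOB

/-- The real kernel `τ ^ (γ - 1) * A (τ ^ β)` of the fractional integrals, cut off to `(0, l]`. -/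
noncomputable def realKernel (A : ℂ → ℂ) (γ : ℝ) (β : ℂ) (l : ℝ) : ℝ → ℝ :=
  (Ioc 0 l).indicator fun τ => τ ^ (γ - 1) * (A ((τ : ℂ) ^ β)).re

/-! ### Continuity and integrability of the analytic kernels -/

section Kernel

variable {A : ℂ → ℂ} {c : ℕ → ℂ} {R γ l : ℝ} {β : ℂ}

theorem IsSeriesOnDisc.continuousOn_closedBall (hA : IsSeriesOnDisc A c R) {r : ℝ} (hr0 : 0 ≤ r)
    (hr : r < R) : ContinuousOn A (Metric.closedBall 0 r) := by
  have hs : Summable fun n => ‖c n * (r : ℂ) ^ n‖ :=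
    (hA r (by simpa [abs_of_nonneg hr0] using hr)).summable.norm
  have h := continuousOn_tsum (f := fun n z => c n * z ^ n) (s := Metric.closedBall (0 : ℂ) r)
    (fun n => by fun_prop) hs (fun n z hz => by
      have hz' : ‖z‖ ≤ r := by simpa using hz
      simp only [norm_mul, norm_pow, Complex.norm_real, Real.norm_eq_abs, abs_of_nonneg hr0]
      gcongr)
  refine h.congr fun z hz => ?_
  have hz' : ‖z‖ ≤ r := by simpa using hz
  exact (hA z (hz'.trans_lt hr)).tsum_eq.symm

theorem cpow_mem_closedBall (hβ : 0 ≤ β.re) {τ : ℝ} (hτ : τ ∈ Ioc 0 l) :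
    (τ : ℂ) ^ β ∈ Metric.closedBall (0 : ℂ) (l ^ β.re) := by
  rw [mem_closedBall_zero_iff, Complex.norm_cpow_eq_rpow_re_of_pos hτ.1]
  exact Real.rpow_le_rpow hτ.1.le hτ.2 hβ

theorem continuousOn_comp_cpow (hA : IsSeriesOnDisc A c R) (hβ : 0 ≤ β.re) (hl : 0 ≤ l)
    (hR : l ^ β.re < R) : ContinuousOn (fun τ : ℝ => (A ((τ : ℂ) ^ β)).re) (Ioc 0 l) := by
  refine Complex.continuous_re.comp_continuousOn
    ((hA.continuousOn_closedBall (Real.rpow_nonneg hl _) hR).comp ?_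
      fun τ hτ => cpow_mem_closedBall hβ hτ)
  intro τ hτ
  refine ContinuousAt.continuousWithinAt ?_
  exact (Complex.continuous_ofReal.continuousAt).cpow continuousAt_const
    (Complex.ofReal_mem_slitPlane.2 hτ.1)

theorem continuousOn_realKernel (hA : IsSeriesOnDisc A c R) (hβ : 0 ≤ β.re) (hl : 0 ≤ l)
    (hR : l ^ β.re < R) : ContinuousOn (realKernel A γ β l) (Ioc 0 l) := by
  have h : ContinuousOn (fun τ : ℝ => τ ^ (γ - 1) * (A ((τ : ℂ) ^ β)).re) (Ioc 0 l) :=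
    ContinuousOn.mul (continuousOn_id.rpow_const fun τ hτ => Or.inl hτ.1.ne')
      (continuousOn_comp_cpow hA hβ hl hR)
  exact h.congr fun τ hτ => indicator_of_mem hτ _

/-- Since `0 ≤ β.re`, the point `τ ^ β` stays in a compact disc on which `A` is bounded; `0 < γ`
makes the remaining power integrable at `0`. -/
theorem integrable_realKernel (hA : IsSeriesOnDisc A c R) (hβ : 0 ≤ β.re) (hl : 0 ≤ l)
    (hR : l ^ β.re < R) (hγ : 0 < γ) : Integrable (realKernel A γ β l) := by
  rw [realKernel, integrable_indicator_iff measurableSet_Ioc]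
  obtain ⟨C, hC⟩ := (isCompact_closedBall (0 : ℂ) (l ^ β.re)).exists_bound_of_continuousOn
    (hA.continuousOn_closedBall (Real.rpow_nonneg hl _) hR)
  have h1 : IntegrableOn (fun τ : ℝ => τ ^ (γ - 1)) (Ioc 0 l) :=
    (intervalIntegrable_iff_integrableOn_Ioc_of_le hl).1
      (intervalIntegral.intervalIntegrable_rpow' (by linarith))
  refine Integrable.mul_bdd (c := C) h1
    ((continuousOn_comp_cpow hA hβ hl hR).aestronglyMeasurable measurableSet_Ioc) ?_
  filter_upwards [ae_restrict_mem measurableSet_Ioc] with τ hτ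
  exact (Complex.abs_re_le_norm _).trans (hC _ (cpow_mem_closedBall hβ hτ))

theorem ofReal_realKernel (hA : IsRealKernel A β l) {τ : ℝ} (hτ : τ ∈ Ioc 0 l) :
    ((realKernel A γ β l τ : ℝ) : ℂ) = ((τ ^ (γ - 1) : ℝ) : ℂ) * A ((τ : ℂ) ^ β) := by
  rw [realKernel, indicator_of_mem hτ, Complex.ofReal_mul]
  congr 1
  exact Complex.ext (by simp) (by simpa using (hA τ hτ).symm)

theorem realKernel_of_notMem {τ : ℝ} (hτ : τ ∉ Ioc 0 l) : realKernel A γ β l τ = 0 :=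
  indicator_of_notMem hτ _

end Kernel

/-! ### Fractional integrals as convolutions on the whole line -/

section Convolution

variable {k f h φ : ℝ → ℝ} {a b t : ℝ}

/-- The cut-off of `k` encodes the moving end point `t` and the indicator the fixed one, so that
translation and Fubini on the line apply. -/
theorem integral_left_eq (hk : ∀ τ ∉ Ioc 0 (b - a), k τ = 0) (ht : t ∈ Icc a b) :
    ∫ s in a..t, k (t - s) * f s = ∫ s, k (t - s) * (Ioc a b).indicator f s := by
  rw [intervalIntegral.integral_of_le ht.1, ← integral_indicator measurableSet_Ioc]
  congr 1
  ext s
  by_cases hs : s ∈ Ioc a t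
  · rw [indicator_of_mem hs, indicator_of_mem (show s ∈ Ioc a b from ⟨hs.1, hs.2.trans ht.2⟩)]
  · rw [indicator_of_notMem hs]
    by_cases hs' : s ∈ Ioc a b
    · rw [hk (t - s), zero_mul]
      rintro ⟨h1, -⟩
      exact hs ⟨hs'.1, by linarith⟩
    · rw [indicator_of_notMem hs', mul_zero]

theorem integral_right_eq (hk : ∀ τ ∉ Ioc 0 (b - a), k τ = 0) (ht : t ∈ Icc a b) :
    ∫ s in t..b, k (s - t) * f s = ∫ s, k (s - t) * (Icc a b).indicator f s := by
  rw [intervalIntegral.integral_of_le ht.2, ← integral_indicator measurableSet_Ioc]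
  congr 1
  ext s
  by_cases hs : s ∈ Ioc t b
  · rw [indicator_of_mem hs, indicator_of_mem (show s ∈ Icc a b from ⟨ht.1.trans hs.1.le, hs.2⟩)]
  · rw [indicator_of_notMem hs]
    by_cases hs' : s ∈ Icc a b
    · rw [hk (s - t), zero_mul]
      rintro ⟨h1, -⟩
      exact hs ⟨by linarith, hs'.2⟩
    · rw [indicator_of_notMem hs', mul_zero]

theorem leftIntegral_eq_ofReal {A : ℂ → ℂ} {γ : ℝ} {β : ℂ} (hA : IsRealKernel A β (b - a))
    (ht : t ∈ Icc a b) : leftIntegral A γ β a f t =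
      ((∫ s, realKernel A γ β (b - a) (t - s) * (Ioc a b).indicator f s : ℝ) : ℂ) := by
  rw [← integral_left_eq (fun τ => realKernel_of_notMem) ht, ← intervalIntegral.integral_ofReal,
    leftIntegral]
  refine intervalIntegral.integral_congr_ae ?_
  -- At `s = t` the cut-off kernel is `0`, whereas the uncut formula need not be when `γ = 1`, since
  -- `0 ^ 0 = 1`.
  filter_upwards [compl_mem_ae_iff.2 (measure_singleton t)] with s hst hs
  rw [uIoc_of_le ht.1] at hs
  have hst' : s < t := lt_of_le_of_ne hs.2 hst
  rw [Complex.ofReal_mul, ofReal_realKernel hA ⟨by linarith, by linarith [hs.1, ht.2]⟩]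

theorem rightIntegral_eq_ofReal {A : ℂ → ℂ} {γ : ℝ} {β : ℂ} (hA : IsRealKernel A β (b - a))
    (ht : t ∈ Icc a b) : rightIntegral A γ β b f t =
      ((∫ s, realKernel A γ β (b - a) (s - t) * (Icc a b).indicator f s : ℝ) : ℂ) := by
  rw [← integral_right_eq (fun τ => realKernel_of_notMem) ht, ← intervalIntegral.integral_ofReal,
    rightIntegral]
  refine intervalIntegral.integral_congr_ae (Eventually.of_forall fun s hs => ?_)
  rw [uIoc_of_le ht.2] at hs
  rw [Complex.ofReal_mul, ofReal_realKernel hA ⟨by linarith [hs.1], by linarith [hs.2, ht.1]⟩]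

theorem integrable_comp_sub_mul (hk : Integrable k) (hh : Integrable h) :
    Integrable (fun p : ℝ × ℝ => h p.2 * k (p.2 - p.1)) (volume.prod volume) := by
  have := hh.convolution_integrand (ContinuousLinearMap.mul ℝ ℝ) hk.comp_neg
  simpa using this

theorem integrable_integral_comp_sub_mul (hk : Integrable k) (hh : Integrable h) :
    Integrable fun s => ∫ t, k (t - s) * h t := by
  simpa [mul_comm] using (integrable_comp_sub_mul hk hh).integral_prod_left

theorem integrable_comp_sub_mul_of_bounded (hk : Integrable k) (hφ : AEStronglyMeasurable φ) {M : ℝ}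
    (hM : ∀ s, |φ s| ≤ M) (t : ℝ) : Integrable fun s => k (t - s) * φ s :=
  (hk.comp_sub_left t).mul_bdd hφ (Eventually.of_forall hM)

/-- Fractional integration by parts: left and right integrals with the same kernel are adjoint.
Absolute convergence comes from the integrable convolution integrand `h t * k (t - s)` and the bound
on `φ`. -/
theorem integral_mul_integral_swap (hk : Integrable k) (hh : Integrable h)
    (hφ : AEStronglyMeasurable φ) {M : ℝ} (hM : ∀ s, |φ s| ≤ M) :
    ∫ t, h t * ∫ s, k (t - s) * φ s = ∫ s, φ s * ∫ t, k (t - s) * h t := by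
  have hi : Integrable (fun p : ℝ × ℝ => φ p.1 * (h p.2 * k (p.2 - p.1))) (volume.prod volume) :=
    (integrable_comp_sub_mul hk hh).bdd_mul hφ.comp_fst (Eventually.of_forall fun p => hM p.1)
  have hswap := integral_integral_swap (f := fun s t => φ s * (h t * k (t - s))) hi
  simp_rw [← integral_const_mul]
  calc _ = ∫ t, ∫ s, φ s * (h t * k (t - s)) := by congr! 4; ring
    _ = ∫ s, ∫ t, φ s * (h t * k (t - s)) := hswap.symm
    _ = _ := by congr! 5; ring

/-- After a reflection `k` is fixed and only `f` is translated, so dominated convergence needs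
continuity of `f` off a null set and none of `k`. -/
theorem continuous_integral_comp_sub_mul (hk : Integrable k) (hf : AEStronglyMeasurable f) {M : ℝ}
    (hM : ∀ s, |f s| ≤ M) (hc : {s | ¬ ContinuousAt f s}.Countable) :
    Continuous fun t => ∫ s, k (t - s) * f s := by
  have h1 : ∀ t, ∫ s, k (t - s) * f s = ∫ σ, k σ * f (t - σ) := fun t => by
    rw [← integral_sub_left_eq_self (fun σ => k σ * f (t - σ)) volume t]
    simp
  simp_rw [h1]
  refine continuous_iff_continuousAt.2 fun t => ?_
  refine continuousAt_of_dominated (bound := fun σ => ‖k σ‖ * M) ?_ ?_ (hk.norm.mul_const M) ?_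
  · refine Eventually.of_forall fun u => hk.aestronglyMeasurable.mul ?_
    exact hf.comp_quasiMeasurePreserving (quasiMeasurePreserving_sub_left volume u)
  · refine Eventually.of_forall fun u => Eventually.of_forall fun σ => ?_
    rw [norm_mul]
    exact mul_le_mul_of_nonneg_left (hM _) (norm_nonneg _)
  · have hc' : {σ | ¬ ContinuousAt f (t - σ)}.Countable :=
      hc.preimage (f := fun σ => t - σ) (sub_right_injective)
    filter_upwards [compl_mem_ae_iff.2 (hc'.measure_zero volume)] with σ hσ
    have hσ' : ContinuousAt f (t - σ) := by simpa using hσ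
    refine ContinuousAt.mul continuousAt_const ?_
    exact ContinuousAt.comp (f := fun u => u - σ) hσ' (by fun_prop)

theorem countable_not_continuousAt_indicator {s : Set ℝ} (hs : (frontier s).Countable)
    (hf : {x | x ∈ interior s ∧ ¬ ContinuousAt f x}.Countable) :
    {x | ¬ ContinuousAt (s.indicator f) x}.Countable := by
  refine (hs.union hf).mono fun x hx => ?_
  by_cases h1 : x ∈ frontier s
  · exact Or.inl h1
  by_cases h2 : x ∈ interior s
  · refine Or.inr ⟨h2, fun h => hx (h.congr ?_)⟩
    filter_upwards [mem_interior_iff_mem_nhds.1 h2] with y hy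
    rw [indicator_of_mem hy]
  · refine absurd ?_ hx
    have h3 : x ∉ closure s := fun h => h1 ⟨h, h2⟩
    refine (continuousAt_const (y := (0 : ℝ))).congr ?_
    filter_upwards [isClosed_closure.isOpen_compl.mem_nhds h3] with y hy
    rw [indicator_of_notMem fun h => hy (subset_closure h)]

/-- Near `t₀ < b` split the integral at some `c` in `(t₀, b)`. On `[a, c]` the function `h` is
bounded and `k` integrable; on `(c, b]` the kernel stays away from its singularity and `h` is
integrable. The two singularities never meet. -/
theorem continuousOn_integral_comp_sub_mul (hk : Integrable k)
    (hkc : ContinuousOn k (Ioc 0 (b - a)))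
    (hh : Integrable h) (hh0 : ∀ t ∉ Icc a b, h t = 0) (hhc : ContinuousOn h (Ico a b)) :
    ContinuousOn (fun t => ∫ s, k (s - t) * h s) (Ico a b) := by
  intro t₀ ht₀
  obtain ⟨c, hc1, hc2⟩ := exists_between ht₀.2
  -- For `t ≤ c'` and `c < s`, the argument `s - t` is at least `c - c' > 0`.
  obtain ⟨c', hc'1, hc'2⟩ := exists_between hc1
  obtain ⟨M, hM⟩ := isCompact_Icc.exists_bound_of_continuousOn
    (hhc.mono (Icc_subset_Ico_right hc2))
  obtain ⟨M', hM'⟩ := (isCompact_Icc (a := c - c') (b := b - a)).exists_bound_of_continuousOn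
    (hkc.mono fun τ hτ => ⟨by linarith [hτ.1], hτ.2⟩)
  have hm : AEStronglyMeasurable ((Icc a c).indicator h) :=
    hh.aestronglyMeasurable.indicator measurableSet_Icc
  have hbd : ∀ s, |(Icc a c).indicator h s| ≤ |M| := fun s => by
    by_cases hs : s ∈ Icc a c
    · rw [indicator_of_mem hs]
      exact (hM s hs).trans (le_abs_self M)
    · simp [indicator_of_notMem hs]
  have hh2 : Integrable ((Ioc c b).indicator h) := hh.indicator measurableSet_Ioc
  have hm2 : ∀ t, AEStronglyMeasurable fun s => k (s - t) * (Ioc c b).indicator h s := fun t =>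
    (hk.comp_sub_right t).aestronglyMeasurable.mul hh2.aestronglyMeasurable
  have hbd2 : ∀ t ∈ Icc a c', ∀ s, ‖k (s - t) * (Ioc c b).indicator h s‖
      ≤ M' * ‖(Ioc c b).indicator h s‖ := fun t ht s => by
    by_cases hs : s ∈ Ioc c b
    · rw [norm_mul]
      exact mul_le_mul_of_nonneg_right
        (hM' _ ⟨by linarith [hs.1, ht.2], by linarith [hs.2, ht.1]⟩) (norm_nonneg _)
    · simp [indicator_of_notMem hs]
  have hnear : ∀ᶠ t in 𝓝[Ico a b] t₀, t ∈ Icc a c' := by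
    filter_upwards [self_mem_nhdsWithin, mem_nhdsWithin_of_mem_nhds (Iio_mem_nhds hc'1)]
      with t h1 h2 using ⟨h1.1, le_of_lt h2⟩
  have hsplit : ∀ t ∈ Icc a c', ∫ s, k (s - t) * h s =
      (∫ s, k (-(t - s)) * (Icc a c).indicator h s)
        + ∫ s, k (s - t) * (Ioc c b).indicator h s := by
    intro t ht
    rw [← integral_add (integrable_comp_sub_mul_of_bounded hk.comp_neg hm hbd t)
      ((hh2.norm.const_mul M').mono' (hm2 t) (Eventually.of_forall (hbd2 t ht)))]
    congr 1
    ext s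
    rw [neg_sub, ← mul_add]
    congr 1
    by_cases h1 : s ∈ Icc a c
    · have h2 : s ∉ Ioc c b := fun h => absurd h.1 (not_lt.2 h1.2)
      rw [indicator_of_mem h1, indicator_of_notMem h2, add_zero]
    · by_cases h2 : s ∈ Ioc c b
      · rw [indicator_of_notMem h1, indicator_of_mem h2, zero_add]
      · rw [indicator_of_notMem h1, indicator_of_notMem h2, add_zero]
        refine hh0 s fun hs => ?_
        rcases le_or_gt s c with h | h
        · exact h1 ⟨hs.1, h⟩
        · exact h2 ⟨h, hs.2⟩
  have hcont1 : Continuous fun t => ∫ s, k (-(t - s)) * (Icc a c).indicator h s := by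
    refine continuous_integral_comp_sub_mul hk.comp_neg hm hbd
      (countable_not_continuousAt_indicator ?_ ?_)
    · rw [frontier_Icc (ht₀.1.trans hc1.le)]
      exact (Set.toFinite _).countable
    · convert countable_empty
      refine eq_empty_of_forall_notMem fun s hs => hs.2 ?_
      rw [interior_Icc] at hs
      exact hhc.continuousAt (Ico_mem_nhds hs.1.1 (hs.1.2.trans hc2))
  have hcont2 : ContinuousWithinAt (fun t => ∫ s, k (s - t) * (Ioc c b).indicator h s)
      (Ico a b) t₀ := by
    refine continuousWithinAt_of_dominated (Eventually.of_forall hm2)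
      (hnear.mono fun t ht => Eventually.of_forall (hbd2 t ht)) (hh2.norm.const_mul M') ?_
    -- When `t₀ = a`, the point `s = b` sends `s - t₀` to the edge `b - a` of the cut-off, where `k`
    -- may jump.
    filter_upwards [compl_mem_ae_iff.2 (measure_singleton b)] with s hsb
    by_cases hs : s ∈ Ioc c b
    · have hsb' : s < b := lt_of_le_of_ne hs.2 hsb
      have hkt : ContinuousAt k (s - t₀) :=
        hkc.continuousAt (Ioc_mem_nhds (by linarith [hs.1]) (by linarith [ht₀.1]))
      refine (ContinuousAt.mul ?_ continuousAt_const).continuousWithinAt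
      exact ContinuousAt.comp (f := fun u => s - u) hkt (by fun_prop)
    · simp only [indicator_of_notMem hs, mul_zero]
      exact continuousWithinAt_const
  refine (hcont1.continuousWithinAt.add hcont2).congr_of_eventuallyEq
    (hnear.mono hsplit) (hsplit t₀ ⟨ht₀.1, hc'1.le⟩)

end Convolution

/-! ### Gluing over a finite partition -/

section Piecewise

theorem continuousOn_preimage_Icc_of_partition {X Y : Type*} [TopologicalSpace X]
    [TopologicalSpace Y] {f : X → Y} {g : X → ℝ} (hg : Continuous g) (p : ℕ → ℝ) (N : ℕ)
    (hN : N ≠ 0) (h : ∀ k < N, p k < p (k + 1) ∧ ContinuousOn f (g ⁻¹' Icc (p k) (p (k + 1)))) :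
    p 0 ≤ p N ∧ ContinuousOn f (g ⁻¹' Icc (p 0) (p N)) := by
  induction N with
  | zero => exact absurd rfl hN
  | succ N ih =>
    rcases eq_or_ne N 0 with rfl | hN'
    · exact ⟨(h 0 one_pos).1.le, (h 0 one_pos).2⟩
    · obtain ⟨h1, h2⟩ := ih hN' fun k hk => h k (hk.trans N.lt_succ_self)
      obtain ⟨h3, h4⟩ := h N N.lt_succ_self
      refine ⟨h1.trans h3.le, ?_⟩
      rw [← Icc_union_Icc_eq_Icc h1 h3.le, preimage_union]
      exact h2.union_of_isClosed h4 (isClosed_Icc.preimage hg) (isClosed_Icc.preimage hg)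

/-- Inside each piece `deriv f` agrees with the continuous one-sided derivative. The finitely many
breakpoints go into `S`. -/
theorem exists_bound_deriv_of_partition {f : ℝ → ℝ} (p : ℕ → ℝ) (N : ℕ)
    (h : ∀ k < N, p k < p (k + 1) ∧ ContDiffOn ℝ 1 f (Icc (p k) (p (k + 1)))) :
    ∃ S : Set ℝ, S.Finite ∧ ∃ M, ∀ s ∈ Icc (p 0) (p N), |deriv f s| ≤ M ∧
      (s ∉ S → ContinuousAt (deriv f) s ∧ DifferentiableAt ℝ f s) := by
  induction N with
  | zero =>
    refine ⟨{p 0}, finite_singleton _, |deriv f (p 0)|, fun s hs => ?_⟩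
    have hs' : s = p 0 := by simpa using hs
    exact ⟨by rw [hs'], fun h => absurd hs' h⟩
  | succ N ih =>
    obtain ⟨S, hS, M, hM⟩ := ih fun k hk => h k (hk.trans N.lt_succ_self)
    obtain ⟨hlt, hf⟩ := h N N.lt_succ_self
    have hc := hf.continuousOn_derivWithin (uniqueDiffOn_Icc hlt) le_rfl
    obtain ⟨C, hC⟩ := isCompact_Icc.exists_bound_of_continuousOn hc
    have hd : ∀ s ∈ Ioo (p N) (p (N + 1)), deriv f s = derivWithin f (Icc (p N) (p (N + 1))) s :=
      fun s hs => (derivWithin_of_mem_nhds (Icc_mem_nhds hs.1 hs.2)).symm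
    -- No piece controls `deriv f` at its end point (it is `0` by default at a corner), so that
    -- value enters the bound separately.
    refine ⟨insert (p (N + 1)) S, hS.insert _, max M (max C |deriv f (p (N + 1))|),
      fun s hs => ?_⟩
    rcases le_or_gt s (p N) with hsN | hsN
    · obtain ⟨h1, h2⟩ := hM s ⟨hs.1, hsN⟩
      exact ⟨h1.trans (le_max_left _ _), fun hs' => h2 fun h => hs' (mem_insert_of_mem _ h)⟩
    rcases hs.2.eq_or_lt with rfl | hlt'
    · exact ⟨(le_max_right _ _).trans (le_max_right _ _), fun h => absurd (mem_insert _ _) h⟩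
    · refine ⟨?_, fun _ => ⟨?_, ?_⟩⟩
      · rw [hd s ⟨hsN, hlt'⟩]
        exact (hC s ⟨hsN.le, hs.2⟩).trans ((le_max_left _ _).trans (le_max_right _ _))
      · refine (hc.continuousAt (Icc_mem_nhds hsN hlt')).congr ?_
        filter_upwards [Ioo_mem_nhds hsN hlt'] with u hu using (hd u hu).symm
      · exact (hf.differentiableOn one_ne_zero).differentiableAt (Icc_mem_nhds hsN hlt')

end Piecewise

/-! ### Caputo derivatives of piecewise smooth curves -/

section Curve

variable {n : ℕ} {a b : ℝ} {x : ℝ → EuclideanSpace ℝ (Fin n)}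

theorem IsPC1Curve.continuousOn (hab : a < b) (hx : IsPC1Curve a b x) :
    ContinuousOn x (Icc a b) := by
  obtain ⟨N, p, rfl, rfl, h⟩ := hx
  have hN : N ≠ 0 := by rintro rfl; exact lt_irrefl _ hab
  exact (continuousOn_preimage_Icc_of_partition (f := x) continuous_id p N hN fun k hk =>
    ⟨(h k hk).1, (h k hk).2.continuousOn⟩).2

theorem IsPC1Curve.add (hx : IsPC1Curve a b x) {y : ℝ → EuclideanSpace ℝ (Fin n)}
    (hy : ContDiff ℝ 1 y) : IsPC1Curve a b (x + y) := by
  obtain ⟨N, p, h0, hN, h⟩ := hx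
  exact ⟨N, p, h0, hN, fun k hk => ⟨(h k hk).1, (h k hk).2.add hy.contDiffOn⟩⟩

theorem IsPC1Curve.exists_bound_deriv (hx : IsPC1Curve a b x) (i : Fin n) :
    ∃ S : Set ℝ, S.Finite ∧ ∃ M, ∀ s ∈ Icc a b, |deriv (fun s => x s i) s| ≤ M ∧
      (s ∉ S → ContinuousAt (deriv fun s => x s i) s ∧
        DifferentiableAt ℝ (fun s => x s i) s) := by
  obtain ⟨N, p, rfl, rfl, h⟩ := hx
  refine exists_bound_deriv_of_partition p N fun k hk => ⟨(h k hk).1, ?_⟩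
  exact (contDiffOn_piLp 2).1 (h k hk).2 i

variable {Abar : ℂ → ℂ} {α : ℝ} {β : ℂ}

theorem caputoLeftVec_apply (hreal : IsRealKernel Abar β (b - a)) {t : ℝ} (ht : t ∈ Icc a b)
    (i : Fin n) : caputoLeftVec Abar α β a x t i =
      ∫ s, realKernel Abar (1 - α) β (b - a) (t - s)
        * (Ioc a b).indicator (deriv fun s => x s i) s := by
  simp [caputoLeftVec, caputoLeft, leftIntegral_eq_ofReal hreal ht]

theorem aestronglyMeasurable_indicator_deriv (i : Fin n) :
    AEStronglyMeasurable ((Ioc a b).indicator (deriv fun s => x s i)) :=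
  ((measurable_deriv _).indicator measurableSet_Ioc).aestronglyMeasurable

theorem IsPC1Curve.exists_bound_indicator_deriv (hx : IsPC1Curve a b x) (i : Fin n) :
    ∃ M, ∀ s, |(Ioc a b).indicator (deriv fun s => x s i) s| ≤ M := by
  obtain ⟨S, hS, M, hM⟩ := hx.exists_bound_deriv i
  refine ⟨|M|, fun s => ?_⟩
  by_cases hs : s ∈ Ioc a b
  · rw [indicator_of_mem hs]
    exact (hM s (Ioc_subset_Icc_self hs)).1.trans (le_abs_self M)
  · simp [indicator_of_notMem hs]

/-- Convolution with an integrable kernel smooths out the finitely many jumps of the bounded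
derivative of `x`. -/
theorem continuousOn_caputoLeftVec (hab : a < b) (hk : Integrable (realKernel Abar (1 - α) β (b - a)))
    (hreal : IsRealKernel Abar β (b - a)) (hx : IsPC1Curve a b x) :
    ContinuousOn (caputoLeftVec Abar α β a x) (Icc a b) := by
  refine (PiLp.continuous_toLp 2 _).comp_continuousOn (continuousOn_pi.2 fun i => ?_)
  obtain ⟨M, hM⟩ := hx.exists_bound_indicator_deriv i
  obtain ⟨S, hS, _, hM'⟩ := hx.exists_bound_deriv i
  refine (continuous_integral_comp_sub_mul hk
    (aestronglyMeasurable_indicator_deriv i) hM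
    (countable_not_continuousAt_indicator ?_ ?_)).continuousOn.congr
      fun t ht => caputoLeftVec_apply hreal ht i
  · rw [frontier_Ioc hab]
    exact (Set.toFinite _).countable
  · refine hS.countable.mono fun s hs => ?_
    by_contra hsS
    rw [interior_Ioc] at hs
    exact hs.2 ((hM' s (Ioo_subset_Icc_self hs.1)).2 hsS).1

theorem caputoLeftVec_add_smul_single (hk : Integrable (realKernel Abar (1 - α) β (b - a)))
    (hreal : IsRealKernel Abar β (b - a)) (hx : IsPC1Curve a b x) {φ : ℝ → ℝ} (hφ : Continuous φ)
    (i : Fin n) (ε : ℝ) {t : ℝ} (ht : t ∈ Icc a b) :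
    caputoLeftVec Abar α β a
        (x + fun s => ε • (∫ r in a..s, φ r) • EuclideanSpace.single i (1 : ℝ)) t =
      caputoLeftVec Abar α β a x t
        + ε • (∫ s, realKernel Abar (1 - α) β (b - a) (t - s) * (Ioc a b).indicator φ s)
          • EuclideanSpace.single i (1 : ℝ) := by
  ext j
  obtain ⟨M, hM⟩ := hx.exists_bound_indicator_deriv j
  obtain ⟨S, hS, _, hM'⟩ := hx.exists_bound_deriv j
  obtain ⟨C, hC⟩ := (isCompact_Icc (a := a) (b := b)).exists_bound_of_continuousOn hφ.continuousOn
  have hC' : ∀ s, |(Ioc a b).indicator φ s| ≤ |C| := fun s => by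
    by_cases hs : s ∈ Ioc a b
    · rw [indicator_of_mem hs]
      exact (hC s (Ioc_subset_Icc_self hs)).trans (le_abs_self C)
    · simp [indicator_of_notMem hs]
  have hφm : AEStronglyMeasurable ((Ioc a b).indicator φ) :=
    hφ.aestronglyMeasurable.indicator measurableSet_Ioc
  have h1 := integrable_comp_sub_mul_of_bounded hk
    (aestronglyMeasurable_indicator_deriv (x := x) (a := a) (b := b) j) hM t
  have h2 := integrable_comp_sub_mul_of_bounded hk hφm hC' t
  rw [caputoLeftVec_apply hreal ht, PiLp.add_apply, caputoLeftVec_apply hreal ht, PiLp.smul_apply,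
    PiLp.smul_apply, smul_eq_mul, smul_eq_mul, ← integral_mul_const, ← integral_const_mul,
    ← integral_add h1 ((h2.mul_const _).const_mul ε)]
  refine integral_congr_ae ?_
  -- At a corner of `x` additivity of `deriv` can fail; these points form a null set.
  filter_upwards [compl_mem_ae_iff.2 (hS.measure_zero volume)] with s hs
  by_cases hs' : s ∈ Ioc a b
  · simp only [indicator_of_mem hs']
    have h3 := ((hM' s (Ioc_subset_Icc_self hs')).2 hs).2.hasDerivAt
    have h4 : HasDerivAt (fun s => ∫ r in a..s, φ r) (φ s) s :=
      intervalIntegral.integral_hasDerivAt_right (hφ.intervalIntegrable _ _)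
        (hφ.stronglyMeasurableAtFilter _ _) hφ.continuousAt
    have h5 := h3.add ((h4.mul_const (EuclideanSpace.single i (1 : ℝ) j)).const_mul ε)
    have h6 : (fun s => (x + fun s => ε • (∫ r in a..s, φ r)
        • EuclideanSpace.single i (1 : ℝ)) s j) = (fun s => x s j) +
          fun s => ε * ((∫ r in a..s, φ r) * EuclideanSpace.single i (1 : ℝ) j) := by
      ext s
      simp
    rw [h6, h5.deriv]
    ring
  · simp [indicator_of_notMem hs']

end Curve

/-! ### Space derivatives of the Lagrangian and differentiation under the integral -/

section Lagrangian

variable {n : ℕ} {a b : ℝ}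
  {L : ℝ → EuclideanSpace ℝ (Fin n) → EuclideanSpace ℝ (Fin n) → ℝ}

theorem IsPC1Lagrangian.continuousOn (hab : a < b) (hL : IsPC1Lagrangian a b L) :
    ContinuousOn (fun q : ℝ × EuclideanSpace ℝ (Fin n) × EuclideanSpace ℝ (Fin n) =>
      L q.1 q.2.1 q.2.2) (Icc a b ×ˢ univ) := by
  obtain ⟨N, p, rfl, rfl, h⟩ := hL
  have hN : N ≠ 0 := by rintro rfl; exact lt_irrefl _ hab
  rw [prod_univ]
  refine (continuousOn_preimage_Icc_of_partition continuous_fst p N hN fun k hk =>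
    ⟨(h k hk).1, ?_⟩).2
  rw [← prod_univ]
  exact (h k hk).2.continuousOn

/-- The differential of `L t` in the variables `(x, u)`. -/
noncomputable def spaceFDeriv
    (L : ℝ → EuclideanSpace ℝ (Fin n) → EuclideanSpace ℝ (Fin n) → ℝ)
    (q : ℝ × EuclideanSpace ℝ (Fin n) × EuclideanSpace ℝ (Fin n)) :
    EuclideanSpace ℝ (Fin n) × EuclideanSpace ℝ (Fin n) →L[ℝ] ℝ :=
  fderiv ℝ (fun z : EuclideanSpace ℝ (Fin n) × EuclideanSpace ℝ (Fin n) => L q.1 z.1 z.2) q.2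

/-- The slab is unrestricted in `z`, so its derivative within the slab restricts to a full
derivative of the slice, even at boundary times. -/
theorem hasFDerivAt_slice {s : Set ℝ}
    (h : DifferentiableOn ℝ (fun q : ℝ × EuclideanSpace ℝ (Fin n) × EuclideanSpace ℝ (Fin n) =>
      L q.1 q.2.1 q.2.2) (s ×ˢ univ)) {t : ℝ} (ht : t ∈ s)
    (z : EuclideanSpace ℝ (Fin n) × EuclideanSpace ℝ (Fin n)) :
    HasFDerivAt (fun z : EuclideanSpace ℝ (Fin n) × EuclideanSpace ℝ (Fin n) => L t z.1 z.2)
      ((fderivWithin ℝ (fun q : ℝ × EuclideanSpace ℝ (Fin n) × EuclideanSpace ℝ (Fin n) =>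
        L q.1 q.2.1 q.2.2) (s ×ˢ univ) (t, z)).comp (ContinuousLinearMap.inr ℝ ℝ _)) z := by
  rw [← hasFDerivWithinAt_univ]
  exact (h (t, z) ⟨ht, mem_univ _⟩).hasFDerivWithinAt.comp z
    (hasFDerivAt_prodMk_right t z).hasFDerivWithinAt fun y _ => ⟨ht, mem_univ _⟩

theorem IsPC1Lagrangian.hasFDerivAt (hL : IsPC1Lagrangian a b L) (hab : a < b) {t : ℝ}
    (ht : t ∈ Icc a b) (z : EuclideanSpace ℝ (Fin n) × EuclideanSpace ℝ (Fin n)) :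
    HasFDerivAt (fun z : EuclideanSpace ℝ (Fin n) × EuclideanSpace ℝ (Fin n) => L t z.1 z.2)
      (spaceFDeriv L (t, z)) z := by
  obtain ⟨N, p, rfl, rfl, h⟩ := hL
  suffices hk : ∃ k < N, t ∈ Icc (p k) (p (k + 1)) by
    obtain ⟨k, hk, htk⟩ := hk
    exact (hasFDerivAt_slice ((h k hk).2.differentiableOn one_ne_zero) htk
      z).differentiableAt.hasFDerivAt
  clear h
  -- If no piece contained `t`, every partition point would lie to the left of `t`; but then the
  -- last piece contains it.
  by_contra! hne
  have : ∀ k ≤ N, p k ≤ t := by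
    intro k
    induction k with
    | zero => exact fun _ => ht.1
    | succ k ih =>
      intro hk
      have h1 := ih (by omega)
      have h2 := hne k (by omega)
      by_contra h3
      exact h2 ⟨h1, (not_le.1 h3).le⟩
  obtain ⟨m, rfl⟩ : ∃ m, N = m + 1 :=
    Nat.exists_eq_succ_of_ne_zero (by rintro rfl; exact lt_irrefl _ hab)
  exact hne m (Nat.lt_succ_self m) ⟨this m (Nat.le_succ m), ht.2⟩

/-- Adjacent slabs share the slice at their common time, hence its space derivative; only the time
derivative of `L` can jump there. -/
theorem IsPC1Lagrangian.continuousOn_spaceFDeriv (hL : IsPC1Lagrangian a b L) (hab : a < b) :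
    ContinuousOn (spaceFDeriv L) (Icc a b ×ˢ univ) := by
  obtain ⟨N, p, rfl, rfl, h⟩ := hL
  have hN : N ≠ 0 := by rintro rfl; exact lt_irrefl _ hab
  rw [prod_univ]
  refine (continuousOn_preimage_Icc_of_partition continuous_fst p N hN fun k hk =>
    ⟨(h k hk).1, ?_⟩).2
  rw [← prod_univ]
  have h1 := (h k hk).2.continuousOn_fderivWithin
    ((uniqueDiffOn_Icc (h k hk).1).prod uniqueDiffOn_univ) le_rfl
  refine (h1.clm_comp (continuousOn_const (c := ContinuousLinearMap.inr ℝ ℝ _))).congr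
    fun q hq => ?_
  exact (hasFDerivAt_slice ((h k hk).2.differentiableOn one_ne_zero) hq.1 q.2).fderiv

variable {X U η ζ : ℝ → EuclideanSpace ℝ (Fin n)} {v : ℝ → ℝ}

theorem hasDerivAt_integral_mul_lagrangian (hL : IsPC1Lagrangian a b L) (hab : a < b)
    (hv : Integrable v) (hX : ContinuousOn X (Icc a b)) (hU : ContinuousOn U (Icc a b))
    (hη : ContinuousOn η (Icc a b)) (hζ : ContinuousOn ζ (Icc a b)) :
    HasDerivAt (fun ε : ℝ => ∫ t in Icc a b, v t * L t (X t + ε • η t) (U t + ε • ζ t))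
      (∫ t in Icc a b, v t * spaceFDeriv L (t, X t, U t) (η t, ζ t)) 0 := by
  have hcurve : ∀ ε : ℝ, ContinuousOn (fun t => (t, X t + ε • η t, U t + ε • ζ t)) (Icc a b) :=
    fun ε => by fun_prop
  have hLc : ∀ ε : ℝ, ContinuousOn (fun t => L t (X t + ε • η t) (U t + ε • ζ t)) (Icc a b) :=
    fun ε => (hL.continuousOn hab).comp (hcurve ε) fun t ht => ⟨ht, mem_univ _⟩
  have hDc : ContinuousOn (fun q : ℝ × ℝ =>
      spaceFDeriv L (q.1, X q.1 + q.2 • η q.1, U q.1 + q.2 • ζ q.1) (η q.1, ζ q.1))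
      (Icc a b ×ˢ Icc (-1) 1) := by
    have hm : MapsTo Prod.fst (Icc a b ×ˢ Icc (-1 : ℝ) 1) (Icc a b) := fun q hq => hq.1
    have e1 := hX.comp continuous_fst.continuousOn hm
    have e2 := hU.comp continuous_fst.continuousOn hm
    have e3 := hη.comp continuous_fst.continuousOn hm
    have e4 := hζ.comp continuous_fst.continuousOn hm
    have e5 : ContinuousOn (fun q : ℝ × ℝ => q.2) (Icc a b ×ˢ Icc (-1 : ℝ) 1) :=
      continuous_snd.continuousOn
    refine ContinuousOn.clm_apply ((hL.continuousOn_spaceFDeriv hab).comp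
      (continuous_fst.continuousOn.prodMk
        ((e1.add (e5.smul e3)).prodMk (e2.add (e5.smul e4)))) fun q hq => ⟨hq.1, mem_univ _⟩)
      (e3.prodMk e4)
  -- Joint continuity in `(t, ε)` on a compact rectangle gives a bound uniform in `ε`, so `‖v t‖ *
  -- C` dominates.
  obtain ⟨C, hC⟩ := (isCompact_Icc.prod isCompact_Icc).exists_bound_of_continuousOn hDc
  have hvm := hv.aestronglyMeasurable.restrict (s := Icc a b)
  have key := hasDerivAt_integral_of_dominated_loc_of_deriv_le
    (μ := volume.restrict (Icc a b)) (s := Ioo (-1 : ℝ) 1) (x₀ := (0 : ℝ))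
    (F := fun ε t => v t * L t (X t + ε • η t) (U t + ε • ζ t))
    (F' := fun ε t => v t * spaceFDeriv L (t, X t + ε • η t, U t + ε • ζ t) (η t, ζ t))
    (bound := fun t => ‖v t‖ * C) (Ioo_mem_nhds (by norm_num) (by norm_num))
    (Eventually.of_forall fun ε => hvm.mul ((hLc ε).aestronglyMeasurable measurableSet_Icc))
    ?_ ?_ ?_ (hv.norm.mul_const C).integrableOn ?_
  · simpa using key.2
  · obtain ⟨M, hM⟩ := isCompact_Icc.exists_bound_of_continuousOn (hLc 0)
    refine hv.integrableOn.mul_bdd ((hLc 0).aestronglyMeasurable measurableSet_Icc) (c := M) ?_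
    filter_upwards [ae_restrict_mem measurableSet_Icc] with t ht using hM t ht
  · refine hvm.mul (ContinuousOn.aestronglyMeasurable ?_ measurableSet_Icc)
    exact hDc.comp (f := fun t => (t, (0 : ℝ))) (by fun_prop)
      fun t ht => ⟨ht, by norm_num, by norm_num⟩
  · filter_upwards [ae_restrict_mem measurableSet_Icc] with t ht ε hε
    rw [norm_mul]
    exact mul_le_mul_of_nonneg_left (hC (t, ε) ⟨ht, hε.1.le, hε.2.le⟩) (norm_nonneg _)
  · filter_upwards [ae_restrict_mem measurableSet_Icc] with t ht ε hε
    refine HasDerivAt.const_mul (v t) ?_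
    have h1 : HasDerivAt (fun ε : ℝ => (X t + ε • η t, U t + ε • ζ t)) (η t, ζ t) ε := by
      have := fun y z : EuclideanSpace ℝ (Fin n) =>
        ((hasDerivAt_id ε).smul_const z).const_add y
      simpa using (this (X t) (η t)).prodMk (this (U t) (ζ t))
    exact (hL.hasFDerivAt hab ht (X t + ε • η t, U t + ε • ζ t)).comp_hasDerivAt ε h1

theorem gradient_apply_of_hasFDerivAt {f : EuclideanSpace ℝ (Fin n) → ℝ}
    {f' : EuclideanSpace ℝ (Fin n) →L[ℝ] ℝ} {y : EuclideanSpace ℝ (Fin n)}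
    (h : HasFDerivAt f f' y) (i : Fin n) :
    gradient f y i = f' (EuclideanSpace.single i 1) := by
  have h1 : inner ℝ (gradient f y) (EuclideanSpace.single i (1 : ℝ))
      = f' (EuclideanSpace.single i 1) := by
    rw [gradient, h.fderiv, InnerProductSpace.toDual_symm_apply]
  rw [EuclideanSpace.inner_single_right] at h1
  simpa using h1

variable {Abar : ℂ → ℂ} {α : ℝ} {β : ℂ} {x : ℝ → EuclideanSpace ℝ (Fin n)}

theorem gradX_apply (hL : IsPC1Lagrangian a b L) (hab : a < b) {t : ℝ} (ht : t ∈ Icc a b)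
    (i : Fin n) : gradX Abar α β a L x t i =
      spaceFDeriv L (t, x t, caputoLeftVec Abar α β a x t) (EuclideanSpace.single i 1, 0) := by
  have h := (hL.hasFDerivAt hab ht (x t, caputoLeftVec Abar α β a x t)).comp (x t)
    (hasFDerivAt_prodMk_left (𝕜 := ℝ) (x t) (caputoLeftVec Abar α β a x t))
  exact gradient_apply_of_hasFDerivAt h i

theorem gradU_apply (hL : IsPC1Lagrangian a b L) (hab : a < b) {t : ℝ} (ht : t ∈ Icc a b)
    (i : Fin n) : gradU Abar α β a L x t i =
      spaceFDeriv L (t, x t, caputoLeftVec Abar α β a x t) (0, EuclideanSpace.single i 1) := by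
  have h := (hL.hasFDerivAt hab ht (x t, caputoLeftVec Abar α β a x t)).comp
    (caputoLeftVec Abar α β a x t)
    (hasFDerivAt_prodMk_right (𝕜 := ℝ) (x t) (caputoLeftVec Abar α β a x t))
  exact gradient_apply_of_hasFDerivAt h i

end Lagrangian

/-! ### The du Bois-Reymond lemma -/

/-- Subtracting its mean makes any smooth test function admissible, which shows that `H` minus its
own mean is orthogonal to all of them. So `H` is constant almost everywhere, and everywhere on `[a,
b)` by continuity. -/
theorem eq_const_of_integral_mul_eq_zero {a b : ℝ} (hab : a < b) {H : ℝ → ℝ} (hH : Integrable H)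
    (hc : ContinuousOn H (Ico a b))
    (h : ∀ φ : ℝ → ℝ, Continuous φ → ∫ s in a..b, φ s = 0 →
      ∫ s, (Ioc a b).indicator φ s * H s = 0) :
    ∃ C, ∀ s ∈ Ico a b, H s = C := by
  have hba : b - a ≠ 0 := (sub_pos.2 hab).ne'
  refine ⟨(∫ s in Ioc a b, H s) / (b - a), ?_⟩
  set C := (∫ s in Ioc a b, H s) / (b - a) with hCdef
  have hae : ∀ᵐ s, s ∈ Ioo a b → H s - C = 0 := by
    refine isOpen_Ioo.ae_eq_zero_of_integral_contDiff_smul_eq_zero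
      ((hH.locallyIntegrable.sub (locallyIntegrable_const C)).locallyIntegrableOn _)
      fun g hg _ hgs => ?_
    have hg0 : ∀ s ∉ Ioc a b, g s = 0 := fun s hs =>
      image_eq_zero_of_notMem_tsupport fun h' => hs (Ioo_subset_Ioc_self (hgs h'))
    have hgc : Continuous g := hg.continuous
    set m := (∫ s in a..b, g s) / (b - a) with hm
    have h1 := h (fun s => g s - m) (by fun_prop) (by
      rw [intervalIntegral.integral_sub (hgc.intervalIntegrable _ _) (by simp),
        intervalIntegral.integral_const, hm, smul_eq_mul]
      field_simp
      ring)
    have h2 : ∀ s, (Ioc a b).indicator (fun s => g s - m) s * H s =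
        (Ioc a b).indicator (fun s => g s * H s - m * H s) s := fun s => by
      by_cases hs : s ∈ Ioc a b
      · simp only [indicator_of_mem hs]; ring
      · simp [indicator_of_notMem hs]
    have hgi : IntegrableOn g (Ioc a b) := (hgc.integrableOn_Icc).mono_set Ioc_subset_Icc_self
    obtain ⟨M, hM⟩ := (isCompact_Icc (a := a) (b := b)).exists_bound_of_continuousOn
      hgc.continuousOn
    have hgH : IntegrableOn (fun s => g s * H s) (Ioc a b) := by
      refine hH.integrableOn.bdd_mul (c := M) hgc.aestronglyMeasurable ?_
      filter_upwards [ae_restrict_mem measurableSet_Ioc] with s hs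
        using hM s (Ioc_subset_Icc_self hs)
    simp_rw [h2] at h1
    rw [integral_indicator measurableSet_Ioc, integral_sub hgH (hH.integrableOn.const_mul m),
      integral_const_mul, sub_eq_zero] at h1
    rw [← setIntegral_eq_integral_of_forall_compl_eq_zero (s := Ioc a b)
      (fun s hs => by rw [hg0 s hs, zero_smul])]
    simp_rw [smul_eq_mul, mul_sub]
    rw [integral_sub hgH (hgi.mul_const C), h1, integral_mul_const, hm, hCdef,
      intervalIntegral.integral_of_le hab.le]
    ring
  have hae' : H =ᵐ[volume.restrict (Ico a b)] fun _ => C := by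
    rw [Filter.EventuallyEq, ae_restrict_iff' measurableSet_Ico]
    filter_upwards [hae, compl_mem_ae_iff.2 (measure_singleton a)] with s h1 h2 h3
    exact sub_eq_zero.1 (h1 ⟨lt_of_le_of_ne h3.1 (Ne.symm h2), h3.2⟩)
  exact Measure.eqOn_Ico_of_ae_eq volume hae' hc continuousOn_const

/-! ### The weight and the functional as a weighted integral -/

section Weight

variable {n : ℕ} {a b α R : ℝ} {β : ℂ} {A Abar : ℂ → ℂ} {c : ℕ → ℂ}

theorem gamma_mul_eq_ofReal (hA1 : (A 1).im = 0) :
    Complex.Gamma α * A 1 = ((Real.Gamma α * (A 1).re : ℝ) : ℂ) := by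
  rw [Complex.Gamma_ofReal, Complex.ofReal_mul]
  congr 1
  exact Complex.ext (by simp) (by simpa using hA1)

theorem weight_eq (hα1 : α < 1) (hA1 : (A 1).im = 0) (hA : IsRealKernel A β (b - a)) {t : ℝ}
    (ht : t ∈ Icc a b) : weight A α β b t =
      realKernel A α β (b - a) (b - t) / (Real.Gamma α * (A 1).re) := by
  rw [weight, gamma_mul_eq_ofReal hA1]
  rcases ht.2.eq_or_lt with rfl | htb
  -- At `t = b` both sides vanish: the power of `0` has the nonzero exponent `α - 1`.
  · rw [realKernel_of_notMem (by simp), sub_self, Real.zero_rpow (by linarith)]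
    simp
  · rw [← ofReal_realKernel hA ⟨by linarith, by linarith [ht.1]⟩, ← Complex.ofReal_div,
      Complex.ofReal_re]

theorem integrable_indicator_weight_mul (hα0 : 0 < α) (hα1 : α < 1) (hβ : 0 ≤ β.re) (hab : a < b)
    (hR : (b - a) ^ β.re < R) (hA : IsSeriesOnDisc A c R) (hAreal : IsRealKernel A β (b - a))
    (hA1 : (A 1).im = 0) {g : ℝ → ℝ} (hg : ContinuousOn g (Icc a b)) :
    Integrable ((Icc a b).indicator fun t => weight A α β b t * g t) := by
  rw [integrable_indicator_iff measurableSet_Icc]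
  obtain ⟨M, hM⟩ := isCompact_Icc.exists_bound_of_continuousOn hg
  have h1 : IntegrableOn (weight A α β b) (Icc a b) := by
    refine IntegrableOn.congr_fun (f := fun t =>
      realKernel A α β (b - a) (b - t) / (Real.Gamma α * (A 1).re)) ?_
      (fun t ht => (weight_eq hα1 hA1 hAreal ht).symm) measurableSet_Icc
    exact (((integrable_realKernel hA hβ (sub_nonneg.2 hab.le) hR hα0).comp_sub_left b).div_const
      _).integrableOn
  refine h1.mul_bdd (hg.aestronglyMeasurable measurableSet_Icc) (c := M) ?_
  filter_upwards [ae_restrict_mem measurableSet_Icc] with t ht using hM t ht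

theorem continuousOn_indicator_weight_mul (hα1 : α < 1) (hβ : 0 ≤ β.re) (hab : a < b)
    (hR : (b - a) ^ β.re < R) (hA : IsSeriesOnDisc A c R) (hAreal : IsRealKernel A β (b - a))
    (hA1 : (A 1).im = 0) {g : ℝ → ℝ} (hg : ContinuousOn g (Icc a b)) :
    ContinuousOn ((Icc a b).indicator fun t => weight A α β b t * g t) (Ico a b) := by
  have h1 : ContinuousOn (fun t => realKernel A α β (b - a) (b - t)) (Ico a b) :=
    (continuousOn_realKernel hA hβ (sub_nonneg.2 hab.le) hR).comp
      (f := fun t => b - t) (by fun_prop)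
      fun t ht => ⟨by linarith [ht.2], by linarith [ht.1]⟩
  refine ((h1.div_const (Real.Gamma α * (A 1).re)).mul (hg.mono Ico_subset_Icc_self)).congr
    fun t ht => ?_
  rw [indicator_of_mem (Ico_subset_Icc_self ht), weight_eq hα1 hA1 hAreal (Ico_subset_Icc_self ht)]
  rfl

theorem functional_eq (hα1 : α < 1) (hab : a < b) (hA : IsRealKernel A β (b - a))
    (hA1 : (A 1).im = 0)
    (L : ℝ → EuclideanSpace ℝ (Fin n) → EuclideanSpace ℝ (Fin n) → ℝ)
    (x : ℝ → EuclideanSpace ℝ (Fin n)) : functional A Abar α β a b L x =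
      ∫ t in Icc a b, weight A α β b t * L t (x t) (caputoLeftVec Abar α β a x t) := by
  rw [functional, leftIntegral_eq_ofReal hA (right_mem_Icc.2 hab.le), gamma_mul_eq_ofReal hA1,
    ← Complex.ofReal_div, Complex.ofReal_re, ← integral_div, integral_Icc_eq_integral_Ioc,
    ← integral_indicator measurableSet_Ioc]
  congr 1
  ext t
  by_cases ht : t ∈ Ioc a b
  · rw [indicator_of_mem ht, indicator_of_mem ht,
      weight_eq hα1 hA1 hA (Ioc_subset_Icc_self ht)]
    ring
  · simp [indicator_of_notMem ht]

end Weight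

/-! ### Ordinary integrals as convolutions, to treat `Φ` like `Z` -/

section UnitKernel

variable {a b t : ℝ} {f : ℝ → ℝ}

/-- The kernel of the integral of order `1`, cut off to `(0, l]`. -/
noncomputable def unitKernel (l : ℝ) : ℝ → ℝ := (Ioc 0 l).indicator fun _ => 1

theorem integrable_unitKernel (l : ℝ) : Integrable (unitKernel l) :=
  (integrable_indicator_iff measurableSet_Ioc).2 (by simp)

theorem continuousOn_unitKernel (l : ℝ) : ContinuousOn (unitKernel l) (Ioc 0 l) :=
  continuousOn_const.congr fun _ hτ => indicator_of_mem hτ _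

theorem integral_eq_unitKernel_left (ht : t ∈ Icc a b) :
    ∫ s in a..t, f s = ∫ s, unitKernel (b - a) (t - s) * (Ioc a b).indicator f s := by
  rw [← integral_left_eq (k := unitKernel (b - a)) (fun τ hτ => indicator_of_notMem hτ _) ht]
  refine intervalIntegral.integral_congr_ae ?_
  filter_upwards [compl_mem_ae_iff.2 (measure_singleton t)] with s hst hs
  rw [uIoc_of_le ht.1] at hs
  have hst' : s < t := lt_of_le_of_ne hs.2 hst
  rw [unitKernel, indicator_of_mem (show t - s ∈ Ioc 0 (b - a) from
    ⟨by linarith, by linarith [hs.1, ht.2]⟩), one_mul]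

theorem integral_eq_unitKernel_right (ht : t ∈ Icc a b) :
    ∫ s in t..b, f s = ∫ s, unitKernel (b - a) (s - t) * (Icc a b).indicator f s := by
  rw [← integral_right_eq (k := unitKernel (b - a)) (fun τ hτ => indicator_of_notMem hτ _) ht]
  refine intervalIntegral.integral_congr_ae (Eventually.of_forall fun s hs => ?_)
  rw [uIoc_of_le ht.2] at hs
  rw [unitKernel, indicator_of_mem (show s - t ∈ Ioc 0 (b - a) from
    ⟨by linarith [hs.1], by linarith [hs.2, ht.1]⟩), one_mul]

end UnitKernel

/-! ### The first variation -/

section EulerLagrange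

variable {n : ℕ} {a b α R : ℝ} {β : ℂ} {A Abar : ℂ → ℂ} {c : ℕ → ℂ}
  {L : ℝ → EuclideanSpace ℝ (Fin n) → EuclideanSpace ℝ (Fin n) → ℝ}
  {xa xb : EuclideanSpace ℝ (Fin n)} {x : ℝ → EuclideanSpace ℝ (Fin n)}

theorem continuousOn_gradX (hL : IsPC1Lagrangian a b L) (hab : a < b)
    (hk : Integrable (realKernel Abar (1 - α) β (b - a)))
    (hreal : IsRealKernel Abar β (b - a)) (hx : IsPC1Curve a b x) (i : Fin n) :
    ContinuousOn (fun t => gradX Abar α β a L x t i) (Icc a b) := by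
  refine ContinuousOn.congr ?_ fun t ht => gradX_apply hL hab ht i
  exact ((hL.continuousOn_spaceFDeriv hab).comp (continuousOn_id.prodMk
    ((hx.continuousOn hab).prodMk (continuousOn_caputoLeftVec hab hk hreal hx)))
      fun t ht => ⟨ht, mem_univ _⟩).clm_apply continuousOn_const

theorem continuousOn_gradU (hL : IsPC1Lagrangian a b L) (hab : a < b)
    (hk : Integrable (realKernel Abar (1 - α) β (b - a)))
    (hreal : IsRealKernel Abar β (b - a)) (hx : IsPC1Curve a b x) (i : Fin n) :
    ContinuousOn (fun t => gradU Abar α β a L x t i) (Icc a b) := by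
  refine ContinuousOn.congr ?_ fun t ht => gradU_apply hL hab ht i
  exact ((hL.continuousOn_spaceFDeriv hab).comp (continuousOn_id.prodMk
    ((hx.continuousOn hab).prodMk (continuousOn_caputoLeftVec hab hk hreal hx)))
      fun t ht => ⟨ht, mem_univ _⟩).clm_apply continuousOn_const

/-- The functional along `x + ε • Φ • e` has a maximum at `ε = 0`, so its derivative there vanishes.
-/
theorem first_variation_eq_zero (hab : a < b) (hα0 : 0 < α) (hα1 : α < 1) (hβ : 0 ≤ β.re)
    (hR : (b - a) ^ β.re < R) (hA : IsSeriesOnDisc A c R) (hAreal : IsRealKernel A β (b - a))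
    (hA1 : (A 1).im = 0) (hk : Integrable (realKernel Abar (1 - α) β (b - a)))
    (hreal : IsRealKernel Abar β (b - a)) (hL : IsPC1Lagrangian a b L)
    (hx : IsSolution A Abar α β a b L xa xb x) (i : Fin n) {φ : ℝ → ℝ} (hφ : Continuous φ)
    (hφ0 : ∫ s in a..b, φ s = 0) :
    (∫ t, (Icc a b).indicator (fun t => weight A α β b t * gradX Abar α β a L x t i) t
        * ∫ s, unitKernel (b - a) (t - s) * (Ioc a b).indicator φ s)
      + (∫ t, (Icc a b).indicator (fun t => weight A α β b t * gradU Abar α β a L x t i) t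
        * ∫ s, realKernel Abar (1 - α) β (b - a) (t - s) * (Ioc a b).indicator φ s) = 0 := by
  obtain ⟨⟨hpc, hxa, hxb⟩, hmax⟩ := hx
  have hxc := hpc.continuousOn hab
  have hUc := continuousOn_caputoLeftVec hab hk hreal hpc
  set e : EuclideanSpace ℝ (Fin n) := EuclideanSpace.single i (1 : ℝ) with he
  set Φ : ℝ → ℝ := fun t => ∫ r in a..t, φ r with hΦ
  set Z : ℝ → ℝ := fun t => ∫ s, realKernel Abar (1 - α) β (b - a) (t - s)
    * (Ioc a b).indicator φ s with hZ
  have hΦd : ∀ t, HasDerivAt Φ (φ t) t := fun t =>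
    intervalIntegral.integral_hasDerivAt_right (hφ.intervalIntegrable _ _)
      (hφ.stronglyMeasurableAtFilter _ _) hφ.continuousAt
  have hΦ1 : ContDiff ℝ 1 Φ := by
    rw [contDiff_one_iff_deriv]
    refine ⟨fun t => (hΦd t).differentiableAt, ?_⟩
    rw [show deriv Φ = φ from funext fun t => (hΦd t).deriv]
    exact hφ
  obtain ⟨M, hM⟩ := (isCompact_Icc (a := a) (b := b)).exists_bound_of_continuousOn
    hφ.continuousOn
  have hφm : AEStronglyMeasurable ((Ioc a b).indicator φ) :=
    hφ.aestronglyMeasurable.indicator measurableSet_Ioc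
  have hbd : ∀ s, |(Ioc a b).indicator φ s| ≤ |M| := fun s => by
    by_cases hs : s ∈ Ioc a b
    · rw [indicator_of_mem hs]
      exact (hM s (Ioc_subset_Icc_self hs)).trans (le_abs_self M)
    · simp [indicator_of_notMem hs]
  have hdisc : {s | ¬ ContinuousAt ((Ioc a b).indicator φ) s}.Countable := by
    refine countable_not_continuousAt_indicator ?_ (by simp [hφ.continuousAt])
    rw [frontier_Ioc hab]
    exact (Set.toFinite _).countable
  have hZc : Continuous Z := continuous_integral_comp_sub_mul hk hφm hbd hdisc
  have hw : Integrable ((Icc a b).indicator (weight A α β b)) := by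
    simpa using integrable_indicator_weight_mul hα0 hα1 hβ hab hR hA hAreal hA1
      (g := fun _ => 1) continuousOn_const
  have hder := hasDerivAt_integral_mul_lagrangian hL hab hw hxc hUc
    (η := fun t => Φ t • e) (ζ := fun t => Z t • e)
    (hΦ1.continuous.smul continuous_const).continuousOn (hZc.smul continuous_const).continuousOn
  have hfun : ∀ ε : ℝ, functional A Abar α β a b L (x + fun s => ε • Φ s • e) =
      ∫ t in Icc a b, (Icc a b).indicator (weight A α β b) t
        * L t (x t + ε • Φ t • e) (caputoLeftVec Abar α β a x t + ε • Z t • e) := fun ε => by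
    rw [functional_eq hα1 hab hAreal hA1]
    refine setIntegral_congr_fun measurableSet_Icc fun t ht => ?_
    simp only [indicator_of_mem ht]
    rw [caputoLeftVec_add_smul_single hk hreal hpc hφ i ε ht]
    rfl
  have hzero : x + (fun s => (0 : ℝ) • Φ s • e) = x := by
    ext s
    simp
  have hlm : IsLocalMax (fun ε : ℝ => ∫ t in Icc a b, (Icc a b).indicator (weight A α β b) t
      * L t (x t + ε • Φ t • e) (caputoLeftVec Abar α β a x t + ε • Z t • e)) 0 := by
    refine Eventually.of_forall fun ε => ?_
    simp only [← hfun]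
    rw [hzero]
    refine hmax _ ⟨hpc.add (by fun_prop), ?_, ?_⟩
    · simp [hΦ, hxa]
    -- The zero mean of `φ` is what preserves the end point at `b`.
    · simp [hΦ, hφ0, hxb]
  have hD := hlm.hasDerivAt_eq_zero hder
  have hi1 : Integrable fun t => (Icc a b).indicator
      (fun t => weight A α β b t * gradX Abar α β a L x t i * Φ t) t := by
    simp_rw [mul_assoc]
    exact integrable_indicator_weight_mul hα0 hα1 hβ hab hR hA hAreal hA1
      ((continuousOn_gradX hL hab hk hreal hpc i).mul hΦ1.continuous.continuousOn)
  have hi2 : Integrable fun t => (Icc a b).indicator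
      (fun t => weight A α β b t * gradU Abar α β a L x t i * Z t) t := by
    simp_rw [mul_assoc]
    exact integrable_indicator_weight_mul hα0 hα1 hβ hab hR hA hAreal hA1
      ((continuousOn_gradU hL hab hk hreal hpc i).mul hZc.continuousOn)
  have e1 : ∀ t, (Icc a b).indicator (fun t => weight A α β b t * gradX Abar α β a L x t i) t
      * ∫ s, unitKernel (b - a) (t - s) * (Ioc a b).indicator φ s =
      (Icc a b).indicator (fun t => weight A α β b t * gradX Abar α β a L x t i * Φ t) t := by
    intro t
    by_cases ht : t ∈ Icc a b
    · rw [indicator_of_mem ht, indicator_of_mem ht, ← integral_eq_unitKernel_left ht]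
    · simp only [indicator_of_notMem ht, zero_mul]
  have e2 : ∀ t, (Icc a b).indicator (fun t => weight A α β b t * gradU Abar α β a L x t i) t
      * Z t =
      (Icc a b).indicator (fun t => weight A α β b t * gradU Abar α β a L x t i * Z t) t := by
    intro t
    by_cases ht : t ∈ Icc a b
    · rw [indicator_of_mem ht, indicator_of_mem ht]
    · simp only [indicator_of_notMem ht, zero_mul]
  simp_rw [e1]
  change _ + ∫ t, (Icc a b).indicator _ t * Z t = 0
  simp_rw [e2]
  rw [← integral_add hi1 hi2, ← hD, ← integral_indicator measurableSet_Icc]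
  congr 1
  ext t
  by_cases ht : t ∈ Icc a b
  · simp only [indicator_of_mem ht]
    rw [gradX_apply hL hab ht, gradU_apply hL hab ht]
    have : ((Φ t • e, Z t • e) : EuclideanSpace ℝ (Fin n) × EuclideanSpace ℝ (Fin n)) =
        Φ t • (e, 0) + Z t • (0, e) := by simp
    rw [this, map_add, map_smul, map_smul, smul_eq_mul, smul_eq_mul]
    ring
  · simp only [indicator_of_notMem ht, add_zero]

end EulerLagrange

end FOB

/-! ### The Euler–Lagrange equation -/

theorem corollary4p5 {n : ℕ} (a b : ℝ) (hab : a < b)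
    (α : ℝ) (hα0 : 0 < α) (hα1 : α < 1) (β : ℂ) (hβ : 0 ≤ β.re)
    (A Abar : ℂ → ℂ) (c d : ℕ → ℂ) (R Rbar : ℝ)
    (hR : (b - a) ^ β.re < R) (hRbar : (b - a) ^ β.re < Rbar)
    (hA : FOB.IsSeriesOnDisc A c R) (hAbar : FOB.IsSeriesOnDisc Abar d Rbar)
    (hconj : FOB.IsConjugate c d α β)
    (hAreal : FOB.IsRealKernel A β (b - a)) (hAbarreal : FOB.IsRealKernel Abar β (b - a))
    (hA1 : A 1 ≠ 0) (hA1real : (A 1).im = 0)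
    (L : ℝ → EuclideanSpace ℝ (Fin n) → EuclideanSpace ℝ (Fin n) → ℝ)
    (hL : FOB.IsPC1Lagrangian a b L)
    (xa xb : EuclideanSpace ℝ (Fin n)) (x : ℝ → EuclideanSpace ℝ (Fin n))
    (hx : FOB.IsSolution A Abar α β a b L xa xb x) :
    ∀ t ∈ Set.Ico a b, ∀ i : Fin n,
      DifferentiableWithinAt ℝ
        (FOB.rightIntegral Abar (1 - α) β b
          (fun s => FOB.weight A α β b s * FOB.gradU Abar α β a L x s i))
        (Set.Icc a b) t ∧
      FOB.rlRight Abar α β a b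
          (fun s => FOB.weight A α β b s * FOB.gradU Abar α β a L x s i) t
        + ((FOB.weight A α β b t * FOB.gradX Abar α β a L x t i : ℝ) : ℂ) = 0 := by
  intro t ht i
  have htc : t ∈ Icc a b := Ico_subset_Icc_self ht
  have hl : 0 ≤ b - a := sub_nonneg.2 hab.le
  have hk : Integrable (FOB.realKernel Abar (1 - α) β (b - a)) :=
    FOB.integrable_realKernel hAbar hβ hl hRbar (by linarith)
  have hgX := FOB.continuousOn_gradX hL hab hk hAbarreal hx.1.1 i
  have hgU := FOB.continuousOn_gradU hL hab hk hAbarreal hx.1.1 i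
  have hXi := FOB.integrable_indicator_weight_mul hα0 hα1 hβ hab hR hA hAreal hA1real hgX
  have hUi := FOB.integrable_indicator_weight_mul hα0 hα1 hβ hab hR hA hAreal hA1real hgU
  have hXc := FOB.continuousOn_indicator_weight_mul hα1 hβ hab hR hA hAreal hA1real hgX
  have hUc := FOB.continuousOn_indicator_weight_mul hα1 hβ hab hR hA hAreal hA1real hgU
  set fX : ℝ → ℝ := fun s => FOB.weight A α β b s * FOB.gradX Abar α β a L x s i with hfX
  set fU : ℝ → ℝ := fun s => FOB.weight A α β b s * FOB.gradU Abar α β a L x s i with hfU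
  have hk1 := FOB.integrable_unitKernel (b - a)
  have hFi := FOB.integrable_integral_comp_sub_mul hk1 hXi
  have hGi := FOB.integrable_integral_comp_sub_mul hk hUi
  have hFc := FOB.continuousOn_integral_comp_sub_mul hk1 (FOB.continuousOn_unitKernel _) hXi
    (fun s hs => indicator_of_notMem hs _) hXc
  have hGc := FOB.continuousOn_integral_comp_sub_mul hk
    (FOB.continuousOn_realKernel hAbar hβ hl hRbar) hUi (fun s hs => indicator_of_notMem hs _) hUc
  obtain ⟨C, hC⟩ := FOB.eq_const_of_integral_mul_eq_zero hab (hFi.add hGi) (hFc.add hGc)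
    (fun φ hφ hφ0 => by
      obtain ⟨M, hM⟩ := (isCompact_Icc (a := a) (b := b)).exists_bound_of_continuousOn
        hφ.continuousOn
      have hφm : AEStronglyMeasurable ((Ioc a b).indicator φ) :=
        hφ.aestronglyMeasurable.indicator measurableSet_Ioc
      have hbd : ∀ s, |(Ioc a b).indicator φ s| ≤ |M| := fun s => by
        by_cases hs : s ∈ Ioc a b
        · rw [indicator_of_mem hs]
          exact (hM s (Ioc_subset_Icc_self hs)).trans (le_abs_self M)
        · simp [indicator_of_notMem hs]
      have h0 := FOB.first_variation_eq_zero hab hα0 hα1 hβ hR hA hAreal hA1real hk hAbarreal hL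
        hx i hφ hφ0
      rw [FOB.integral_mul_integral_swap hk1 hXi hφm hbd,
        FOB.integral_mul_integral_swap hk hUi hφm hbd,
        ← integral_add (hFi.bdd_mul hφm (Eventually.of_forall hbd))
          (hGi.bdd_mul hφm (Eventually.of_forall hbd))] at h0
      simpa only [Pi.add_apply, mul_add] using h0)
  -- Solving `H = C` for the fractional term exhibits it as a primitive.
  have heq : ∀ s ∈ Ico a b, FOB.rightIntegral Abar (1 - α) β b fU s
      = ((C - ∫ r in s..b, (Icc a b).indicator fX r : ℝ) : ℂ) := fun s hs => by
    have hs' : s ∈ Icc a b := Ico_subset_Icc_self hs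
    rw [FOB.rightIntegral_eq_ofReal hAbarreal hs', ← hC s hs,
      FOB.integral_eq_unitKernel_right hs', indicator_indicator, inter_self, Pi.add_apply]
    congr 1
    ring
  -- Lets the fundamental theorem of calculus work within `Icc a b`, which covers the one-sided case
  -- `t = a`.
  have : Fact (t ∈ Icc a b) := ⟨htc⟩
  have hFd : HasDerivWithinAt (fun s => ∫ r in s..b, (Icc a b).indicator fX r)
      (-(Icc a b).indicator fX t) (Icc a b) t := by
    refine intervalIntegral.integral_hasDerivWithinAt_left hXi.intervalIntegrable
      (s := Icc a b) (t := Icc a b)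
      (hXi.aestronglyMeasurable.stronglyMeasurableAtFilter) ?_
    exact (hXc t ht).mono_of_mem_nhdsWithin (by
      filter_upwards [self_mem_nhdsWithin, mem_nhdsWithin_of_mem_nhds (Iio_mem_nhds ht.2)]
        with s h1 h2 using ⟨h1.1, h2⟩)
  have hGd : HasDerivWithinAt (FOB.rightIntegral Abar (1 - α) β b fU)
      ((fX t : ℝ) : ℂ) (Icc a b) t := by
    have h1 := (hFd.const_sub C).ofReal_comp
    rw [neg_neg, indicator_of_mem htc] at h1
    refine h1.congr_of_eventuallyEq ?_ (heq t ht)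
    filter_upwards [self_mem_nhdsWithin, mem_nhdsWithin_of_mem_nhds (Iio_mem_nhds ht.2)]
      with s h1 h2 using heq s ⟨h1.1, h2⟩
  refine ⟨hGd.differentiableWithinAt, ?_⟩
  rw [FOB.rlRight, hGd.derivWithin (uniqueDiffOn_Icc hab t htc)]
  exact neg_add_cancel _
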